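/- For a finite connected graph $G$ on $n(G)$ vertices, a configuration is a function $C\colon V(G)\to\mathbb{N}$, of size $\sum_v C(v)$. A pebbling step along an edge $uv$ removes two pebbles from $u$ and adds one pebble to $v$. A configuration solves the root $r$ if some (possibly empty) sequence of pebbling steps leads to a configuration with at least one pebble on $r$. Let $\pi(G,r)$ be the least $t$ such that every configuration of size $t$ solves $r$, and let $\pi(G)=\max_r\pi(G,r)$. The graph $G$ is Class 0 if $\pi(G)=n(G)$. For $k\in\mathbb{N}$ the graph power $G^{(k)}$ has vertex set $V(G)$, distinct vertices being adjacent when their distance in $G$ is at most $k$ (set $\pi=\infty$ for a disconnected graph with at least two vertices, which concerns only $k=0$). The pebbling exponent $e_\pi(G)$ is the least $e$ such that $G^{(e)}$ is Class 0. Write $\lg=\log_2$, and let $C_n$ be the cycle on $n$ vertices. **Theorem.** For every $n\ge 3$ the pebbling exponent of $C_n$ exists (some power of $C_n$ is Class 0) and satisfies $$\frac{n/2}{\lg n}\le e_\pi(C_n)\le\frac{n/2}{\lg n-\lg\lg n},$$ where the lower bound is asserted for $n\neq 5$ only (the upper bound holds for $n=5$ too). -/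

import Mathlib

namespace GraphPebbling

variable {V : Type*}

/-- One pebbling step along an edge `u v`: two pebbles leave `u`, one pebble arrives at `v`,
and every other vertex keeps its pebbles. A configuration is a function `V → ℕ`. -/
def Step (G : SimpleGraph V) (C D : V → ℕ) : Prop :=
  ∃ u v, G.Adj u v ∧ C u = D u + 2 ∧ D v = C v + 1 ∧ ∀ w, w ≠ u → w ≠ v → D w = C w

/-- `C` solves the root `r`: some (possibly empty) sequence of pebbling steps starting at `C`
leads to a configuration with a pebble on `r`. -/
def Solves (G : SimpleGraph V) (r : V) (C : V → ℕ) : Prop :=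
  ∃ D, Relation.ReflTransGen (Step G) C D ∧ 1 ≤ D r

/-- `π(G, r)`: the least `t` such that every configuration of size `t` solves `r`
(`⊤` if there is no such `t`, which happens only for disconnected graphs). -/
noncomputable def rootedPebblingNumber [Fintype V] (G : SimpleGraph V) (r : V) : ℕ∞ :=
  ⨅ t ∈ {t : ℕ | ∀ C : V → ℕ, ∑ v, C v = t → Solves G r C}, (t : ℕ∞)

/-- The pebbling number `π(G)`, the maximum of `π(G, r)` over all roots `r`. -/
noncomputable def pebblingNumber [Fintype V] (G : SimpleGraph V) : ℕ∞ :=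
  ⨆ r, rootedPebblingNumber G r

/-- `G` is Class 0 if its pebbling number is its number of vertices. -/
def IsClassZero [Fintype V] (G : SimpleGraph V) : Prop :=
  pebblingNumber G = (Fintype.card V : ℕ∞)

/-- The graph power `G^(k)`: distinct vertices are adjacent when their distance in `G` is at
most `k` (the extended distance is `⊤` for vertices in different components). -/
def graphPower (G : SimpleGraph V) (k : ℕ) : SimpleGraph V where
  Adj u v := u ≠ v ∧ G.edist u v ≤ (k : ℕ∞)
  symm := ⟨fun _ _ h => ⟨h.1.symm, by rw [SimpleGraph.edist_comm]; exact h.2⟩⟩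
  loopless := ⟨fun _ h => h.1 rfl⟩

/-- The pebbling exponent `e_π(G)`: the least `e` for which `G^(e)` is Class 0. -/
noncomputable def pebblingExponent [Fintype V] (G : SimpleGraph V) : ℕ :=
  sInf {e : ℕ | IsClassZero (graphPower G e)}

end GraphPebbling

/-!
The vertices of the cycle other than the root `r` form a line with positions `1, …, n - 1`, with
the root at both ends `0` and `n`.

**Upper bound.** The power `C_n^(k)` is Class 0 as soon as `2 ^ (n - 2) ≤ (2 * k) ^ (2 * k)`
(`isClassZero_graphPower_cycleGraph`). Consider an unsolvable configuration with `n` pebbles. As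
the root is empty, the surplus `∑ (C x - 1)` over the vertices with at least two pebbles is the
number of empty vertices, the root included. For each `t < k` there is a chain
`0, k - t, 2 * k - t, …` of vertices, consecutive ones being adjacent, and every vertex on the line
can send half of its pebbles to the chain vertex below it. If `⌈(x + t) / k⌉` is the number of
moves from `x` to the root, then a surplus pebble on `x` has weight `2 ^ (-⌈(x + t) / k⌉)`, and so
has an isolated pebble on a chain vertex `x`. Unsolvability means that the total weight is smaller
than `1`; as the weights are dyadic, the surplus pebbles weigh at most as much as the empty
chain vertices (`sum_surplus_le_of_chain`). The sum over the `k` chains involves every empty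
vertex exactly once (`sum_surplus_le`). The chains stop at position `n - 1 - k`, because the
neighbours of the root have at most one pebble and need not move. Doing the same from the other end, a surplus pebble gets
total weight at least `1 / 2`, by Hermite's identity and the inequality between geometric and
arithmetic mean (`half_le_sum_pow_hops`), while an empty vertex other than the root accounts for
at most `1 / 2`. So the surplus is at most the number of empty vertices other than the root, a
contradiction. A suitable `k` below the claimed bound exists for all `n ≥ 3`
(`exists_bounds_of_lt`, `exists_bounds_of_ge`).

**Lower bound.** If `k < (n / 2) / logb 2 n`, that is `n ^ (2 * k) < 2 ^ n`, and `n ≠ 5`, then `n`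
pebbles on the vertices opposite to the root need not solve it (`not_isClassZero_graphPower_cycleGraph`): weigh a
pebble at `x` by `2 ^ (-⌈x / k⌉)`, or by `2 ^ (-⌈(n - x) / k⌉)`. As long as both total weights are
below `1`, no neighbour of the root has two pebbles; so no step reaches the root or jumps over it,
and neither total increases (`not_solves_of_weight_lt`).
-/

namespace GraphPebbling

/-! ### Pebbling steps and weights -/

theorem Solves.of_one_le {V : Type*} {G : SimpleGraph V} {r : V} {C : V → ℕ} (h : 1 ≤ C r) :
    Solves G r C :=
  ⟨C, .refl, h⟩

theorem Solves.of_step {V : Type*} {G : SimpleGraph V} {r : V} {C D : V → ℕ}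
    (h : Step G C D) (hD : Solves G r D) : Solves G r C := by
  obtain ⟨E, hE, hr⟩ := hD
  exact ⟨E, hE.head h, hr⟩

theorem exists_step {V : Type*} {G : SimpleGraph V} {C : V → ℕ} {u v : V} (h : G.Adj u v)
    (hu : 2 ≤ C u) :
    ∃ D, Step G C D ∧ C u = D u + 2 ∧ D v = C v + 1 ∧ ∀ w, w ≠ u → w ≠ v → D w = C w := by
  classical
  have hne : u ≠ v := h.ne
  refine ⟨fun w => if w = u then C u - 2 else if w = v then C v + 1 else C w,
    ⟨u, v, h, ?_⟩, ?_⟩ <;>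
  · refine ⟨by simp; omega, by simp [hne.symm], fun w h1 h2 => by simp [h1, h2]⟩

theorem Solves.of_adj_of_two_le {V : Type*} {G : SimpleGraph V} {r : V} {C : V → ℕ} {u : V}
    (h : G.Adj u r) (hu : 2 ≤ C u) : Solves G r C := by
  obtain ⟨D, hD, -, h2, -⟩ := exists_step h hu
  exact .of_step hD (.of_one_le (by omega))

/-- A weight argument for solving a root `v i₀`. The vertices are indexed by `ι`; every index in
`Y ∪ D` has a parent, which lies in `Y` or is the root. Along `Y` the weight at least doubles from
an index to its parent. Pebbles on `Y` count with their weight, and pairs of pebbles on `D` count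
with the weight of the parent, to which one pebble of the pair can be moved. Moving pebbles to the
parents does not decrease the total, and it is possible as long as the total exceeds the weight
of a configuration with one pebble on each vertex of `Y`. -/
theorem solves_of_weight_le {V ι : Type*} [DecidableEq ι] {G : SimpleGraph V} {v : ι → V} {i₀ : ι}
    {Y D : Finset ι} {p : ι → ι} {W : ι → ℕ} (hv : Set.InjOn v (insert i₀ (Y ∪ D) : Finset ι))
    (hYD : Disjoint Y D) (hp : ∀ i ∈ Y ∪ D, p i ∈ insert i₀ Y)
    (hadj : ∀ i ∈ Y ∪ D, G.Adj (v i) (v (p i)))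
    (hW : ∀ i ∈ Y, W (p i) = 2 * W i) (hlt : ∑ i ∈ Y, W i < W i₀) (C : V → ℕ)
    (hC : W i₀ ≤ ∑ i ∈ Y, C (v i) * W i + ∑ i ∈ D, C (v i) / 2 * W (p i)) :
    Solves G (v i₀) C := by
  induction hm : ∑ i ∈ Y, C (v i) + ∑ i ∈ D, C (v i) using Nat.strong_induction_on
    generalizing C with
  | _ m ih =>
  obtain ⟨i, hi, hCi⟩ : ∃ i ∈ Y ∪ D, 2 ≤ C (v i) := by
    by_contra! h
    have h1 : ∑ i ∈ Y, C (v i) * W i ≤ ∑ i ∈ Y, W i := by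
      refine Finset.sum_le_sum fun i hi => ?_
      have := h i (Finset.mem_union_left _ hi)
      calc C (v i) * W i ≤ 1 * W i := Nat.mul_le_mul_right _ (by omega)
        _ = W i := one_mul _
    have h2 : ∑ i ∈ D, C (v i) / 2 * W (p i) = 0 := by
      refine Finset.sum_eq_zero fun i hi => ?_
      have := h i (Finset.mem_union_right _ hi)
      rw [Nat.div_eq_of_lt this, zero_mul]
    omega
  obtain ⟨C', hstep, hu, hw, hother⟩ := exists_step (hadj i hi) hCi
  by_cases hpi : p i = i₀
  · rw [hpi] at hw
    exact .of_step hstep (.of_one_le (by omega))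
  have hpY : p i ∈ Y := by simpa [hpi] using hp i hi
  have hpD : p i ∉ D := Finset.disjoint_left.1 hYD hpY
  have hne : i ≠ p i := fun h => (hadj i hi).ne (congrArg v h)
  -- the effect of the step at every index
  have key : ∀ j ∈ Y ∪ D, C' (v j) + (if j = i then 2 else 0)
      = C (v j) + (if j = p i then 1 else 0) := by
    intro j hj
    by_cases h1 : j = i
    · subst h1; simp [hne, hu]
    by_cases h2 : j = p i
    · subst h2; simp [h1, hw]
    · have hj' : j ∈ (insert i₀ (Y ∪ D) : Finset ι) := Finset.mem_insert_of_mem hj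
      have e1 : v j ≠ v i := fun h => h1 (hv hj' (Finset.mem_insert_of_mem hi) h)
      have e2 : v j ≠ v (p i) := fun h =>
        h2 (hv hj' (Finset.mem_insert_of_mem (Finset.mem_union_left _ hpY)) h)
      simp [h1, h2, hother _ e1 e2]
  have sY : ∑ j ∈ Y, C' (v j) + (if i ∈ Y then 2 else 0) = ∑ j ∈ Y, C (v j) + 1 := by
    have := Finset.sum_congr (rfl : Y = Y) fun j hj => key j (Finset.mem_union_left _ hj)
    simpa [Finset.sum_add_distrib, hpY] using this
  have sD : ∑ j ∈ D, C' (v j) + (if i ∈ D then 2 else 0) = ∑ j ∈ D, C (v j) := by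
    have := Finset.sum_congr (rfl : D = D) fun j hj => key j (Finset.mem_union_right _ hj)
    simpa [Finset.sum_add_distrib, hpD] using this
  have wY : ∑ j ∈ Y, C' (v j) * W j + (if i ∈ Y then 2 * W i else 0)
      = ∑ j ∈ Y, C (v j) * W j + W (p i) := by
    have := Finset.sum_congr (rfl : Y = Y) fun j hj =>
      congrArg (· * W j) (key j (Finset.mem_union_left _ hj))
    simpa [Finset.sum_add_distrib, hpY, add_mul, ite_mul] using this
  have wD : ∑ j ∈ D, C' (v j) / 2 * W (p j) + (if i ∈ D then W (p i) else 0)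
      = ∑ j ∈ D, C (v j) / 2 * W (p j) := by
    have : ∀ j ∈ D, C' (v j) / 2 * W (p j) + (if j = i then W (p j) else 0)
        = C (v j) / 2 * W (p j) := by
      intro j hj
      have h2 : j ≠ p i := fun h => hpD (h ▸ hj)
      have := key j (Finset.mem_union_right _ hj)
      by_cases h1 : j = i
      · subst h1
        rw [hu, Nat.add_div_right _ two_pos]
        simp [Nat.succ_mul]
      · simp only [h1, h2, if_false, add_zero] at this ⊢
        rw [this]
    have := Finset.sum_congr (rfl : D = D) this
    simpa [Finset.sum_add_distrib] using this
  refine .of_step hstep (ih _ ?_ C' ?_ rfl)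
  · rcases Finset.mem_union.1 hi with h | h
    · have : i ∉ D := Finset.disjoint_left.1 hYD h
      simp only [h, this, if_true, if_false] at sY sD
      omega
    · have : i ∉ Y := Finset.disjoint_right.1 hYD h
      simp only [h, this, if_true, if_false] at sY sD
      omega
  · rcases Finset.mem_union.1 hi with h | h
    · have : i ∉ D := Finset.disjoint_left.1 hYD h
      simp only [h, this, if_true, if_false] at wY wD
      have := hW i h
      omega
    · have : i ∉ Y := Finset.disjoint_right.1 hYD h
      simp only [h, this, if_true, if_false] at wY wD
      omega

/-! ### Weights along a line -/

/-- The number of jumps of length at most `k` that are needed to cover the distance `x`. This is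
`⌈x / k⌉` for `0 < k`. -/
def hops (k x : ℕ) : ℕ := (x + k - 1) / k

theorem hops_eq_iff {k x h : ℕ} (hk : 0 < k) (hx : 0 < x) :
    hops k x = h + 1 ↔ k * h < x ∧ x ≤ k * (h + 1) := by
  unfold hops
  rw [Nat.div_eq_iff hk, mul_comm k h, mul_comm k (h + 1), add_mul]
  omega

theorem exists_hops_eq {k x : ℕ} (hk : 0 < k) (hx : 0 < x) :
    ∃ h, hops k x = h + 1 ∧ k * h < x ∧ x ≤ k * (h + 1) := by
  refine ⟨(x - 1) / k, ?_⟩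
  have h := (hops_eq_iff (x := x) (h := (x - 1) / k) hk hx)
  have h1 := Nat.div_add_mod (x - 1) k
  have h2 := Nat.mod_lt (x - 1) hk
  have : k * ((x - 1) / k) < x ∧ x ≤ k * ((x - 1) / k + 1) := by
    rw [mul_add]; omega
  exact ⟨h.2 this, this⟩

theorem hops_mul {k h : ℕ} (hk : 0 < k) : hops k (k * h) = h := by
  unfold hops
  rw [Nat.add_sub_assoc hk, Nat.mul_add_div hk, Nat.div_eq_of_lt (by omega), add_zero]

theorem hops_mono {k x y : ℕ} (h : x ≤ y) : hops k x ≤ hops k y :=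
  Nat.div_le_div_right (by omega)

theorem hops_add_self {k x : ℕ} (hk : 0 < k) : hops k (x + k) = hops k x + 1 := by
  unfold hops
  rw [show x + k + k - 1 = x + k - 1 + k by omega, Nat.add_div_right _ hk]

theorem hops_le_one {k x : ℕ} (hk : 0 < k) (hx : x ≤ k) : hops k x ≤ 1 := by
  simpa using (hops_mono hx).trans_eq (by simpa using hops_mul (h := 1) hk)

theorem two_le_hops {k x : ℕ} (hk : 0 < k) (hx : k < x) : 2 ≤ hops k x := by
  obtain ⟨h, e, -, h2⟩ := exists_hops_eq hk (show 0 < x by omega)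
  rcases h with _ | h
  · omega
  · omega

theorem one_le_hops {k x : ℕ} (hk : 0 < k) (hx : 0 < x) : 1 ≤ hops k x := by
  obtain ⟨h, e, -⟩ := exists_hops_eq hk hx
  omega

/-- Hermite's identity for `⌈x / k⌉`. -/
theorem sum_hops {k : ℕ} (hk : 0 < k) (x : ℕ) :
    ∑ t ∈ Finset.range k, hops k (x + t) + 1 = x + k := by
  induction x with
  | zero =>
    obtain ⟨k, rfl⟩ := Nat.exists_eq_add_of_le' hk
    rw [Finset.sum_range_succ']
    have : ∀ t ∈ Finset.range k, hops (k + 1) (0 + (t + 1)) = 1 := by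
      intro t ht
      rw [Finset.mem_range] at ht
      exact (hops_eq_iff (h := 0) hk (by omega)).2 (by omega)
    rw [Finset.sum_congr rfl this]
    simp [hops]
  | succ x ih =>
    have h1 := Finset.sum_range_succ (fun t => hops k (x + t)) k
    have h2 := Finset.sum_range_succ' (fun t => hops k (x + t)) k
    have h3 := hops_add_self (x := x) hk
    simp only [add_zero] at h2
    have : ∀ t, x + 1 + t = x + (t + 1) := by intro t; omega
    simp only [this]
    omega

section Line

variable {V : Type*} {G : SimpleGraph V} {v : ℕ → V} {N k : ℕ}

/-- The chain of vertices `k - t, 2 * k - t, …` on a line on which vertices at distance at most `k`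
are adjacent. If the root cannot be solved, then the surplus pebbles, weighted by their distance to
the root along the chain, are outweighed by the empty vertices of the chain. -/
theorem sum_surplus_le_of_chain (hk : 0 < k) (hv : Set.InjOn v (Set.Iic N))
    (hadj : ∀ x y, x < y → y ≤ N → y ≤ x + k → G.Adj (v y) (v x)) {C : V → ℕ}
    (hC : ¬ Solves G (v 0) C) {t : ℕ} (ht : t < k) :
    ∑ x ∈ Finset.Icc 1 N, ((C (v x) - 1 : ℕ) : ℝ) * (1 / 2) ^ hops k (x + t) ≤
      ∑ x ∈ Finset.Icc 1 N, if k ∣ x + t then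
        (if C (v x) = 0 then (1 / 2 : ℝ) ^ hops k (x + t) else 0) else 0 := by
  set L := (N + t) / k with hL
  have hL1 : k * L ≤ N + t := Nat.mul_div_le _ _
  have hL2 : ∀ h, k * h ≤ N + t → h ≤ L := fun h hh => by
    rw [hL, Nat.le_div_iff_mul_le hk, mul_comm]; exact hh
  set p : ℕ → ℕ := fun x => k * (hops k (x + t) - 1) - t with hpdef
  set W : ℕ → ℕ := fun x => if x = 0 then 2 ^ L else 2 ^ (L - hops k (x + t)) with hWdef
  set Y := {x ∈ Finset.Icc 1 N | k ∣ x + t} with hY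
  set D := {x ∈ Finset.Icc 1 N | ¬ k ∣ x + t} with hD
  have hYDu : Y ∪ D = Finset.Icc 1 N := Finset.filter_union_filter_not_eq _ _
  -- the parent of a vertex one level above the first, and of a vertex at the first level
  have hpar : ∀ x ∈ Finset.Icc 1 N, ∃ h, hops k (x + t) = h + 1 ∧ k * h < x + t ∧
      x + t ≤ k * (h + 1) ∧ h ≤ L ∧ p x = k * h - t ∧
      ((h = 0 ∧ p x = 0) ∨ (1 ≤ h ∧ 1 ≤ p x ∧ p x + t = k * h)) ∧ p x < x ∧ x ≤ p x + k := by
    intro x hx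
    rw [Finset.mem_Icc] at hx
    obtain ⟨h, e, h1, h2⟩ := exists_hops_eq hk (show 0 < x + t by omega)
    have hp : p x = k * h - t := by simp [hpdef, e]
    refine ⟨h, e, h1, h2, hL2 _ (by omega), hp, ?_⟩
    rw [hp, mul_add] at *
    rcases h with _ | h
    · simp at h1 h2 ⊢; omega
    · rw [mul_add] at *; omega
  have hWpar : ∀ x ∈ Finset.Icc 1 N, ∀ h, hops k (x + t) = h + 1 → W (p x) = 2 ^ (L - h) := by
    intro x hx h e
    obtain ⟨h', e', h1, h2, h3, hp, h4, -⟩ := hpar x hx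
    obtain rfl : h = h' := by omega
    rcases h4 with ⟨rfl, h4⟩ | ⟨h4, h5, h6⟩
    · simp [hWdef, h4]
    · simp only [hWdef]
      rw [if_neg (by omega), h6, hops_mul hk]
  have hYlev : ∀ x ∈ Y, 1 ≤ hops k (x + t) ∧ hops k (x + t) ≤ L ∧ k * hops k (x + t) = x + t := by
    intro x hx
    obtain ⟨hx, q, hq⟩ := Finset.mem_filter.1 hx
    obtain ⟨h, e, -⟩ := hpar x hx
    rw [Finset.mem_Icc] at hx
    have hops_eq : hops k (x + t) = q := by rw [hq, hops_mul hk]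
    rw [hops_eq, ← hq]
    exact ⟨by omega, hL2 _ (by omega), rfl⟩
  have hWY : ∀ x ∈ Y, W x = 2 ^ (L - hops k (x + t)) := by
    intro x hx
    have := (Finset.mem_Icc.1 (Finset.mem_filter.1 hx).1).1
    simp only [hWdef]
    rw [if_neg (by omega)]
  have hsum : ∑ x ∈ Y, W x + 1 = 2 ^ L := by
    have h1 : ∑ x ∈ Y, W x = ∑ i ∈ Finset.range L, 2 ^ i := by
      refine Finset.sum_nbij' (fun x => L - hops k (x + t)) (fun i => k * (L - i) - t)
        ?_ ?_ ?_ ?_ ?_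
      · intro x hx
        have := hYlev x hx
        rw [Finset.mem_range]; omega
      · intro i hi
        rw [Finset.mem_range] at hi
        have h1 : k * 1 ≤ k * (L - i) := Nat.mul_le_mul_left _ (by omega)
        have h2 : k * (L - i) ≤ k * L := Nat.mul_le_mul_left _ (by omega)
        rw [Finset.mem_filter, Finset.mem_Icc, Nat.sub_add_cancel (by omega)]
        exact ⟨by omega, dvd_mul_right _ _⟩
      · intro x hx
        obtain ⟨h1, h2, h3⟩ := hYlev x hx
        rw [show L - (L - hops k (x + t)) = hops k (x + t) by omega, h3]
        omega
      · intro i hi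
        rw [Finset.mem_range] at hi
        have h1 : k * 1 ≤ k * (L - i) := Nat.mul_le_mul_left _ (by omega)
        rw [Nat.sub_add_cancel (by omega), hops_mul hk]
        omega
      · intro x hx
        exact hWY x hx
    rw [h1, Nat.geomSum_eq le_rfl]
    have := Nat.one_le_two_pow (n := L)
    simp; omega
  have hW0 : W 0 = 2 ^ L := by simp [hWdef]
  -- weights are integers, so `< 2 ^ L` means `≤ 2 ^ L - 1`, the total weight of the chain
  have main : ∑ x ∈ Y, C (v x) * W x + ∑ x ∈ D, C (v x) / 2 * W (p x) ≤ ∑ x ∈ Y, W x := by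
    by_contra hlt
    refine hC (solves_of_weight_le (Y := Y) (D := D) (p := p) (W := W) ?_ ?_ ?_ ?_ ?_ ?_ C ?_)
    · refine hv.mono fun x hx => ?_
      simp [hYDu] at hx
      simp only [Set.mem_Iic]; omega
    · exact Finset.disjoint_filter_filter_not _ _ _
    · intro x hx
      rw [hYDu] at hx
      obtain ⟨h, -, -, -, -, -, h4, h5, -⟩ := hpar x hx
      rw [Finset.mem_Icc] at hx
      rw [Finset.mem_insert, Finset.mem_filter, Finset.mem_Icc]
      rcases h4 with ⟨-, h4⟩ | ⟨-, h4, h6⟩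
      · exact .inl h4
      · exact .inr ⟨by omega, h6 ▸ dvd_mul_right _ _⟩
    · intro x hx
      rw [hYDu] at hx
      obtain ⟨h, -, -, -, -, -, -, h5, h6⟩ := hpar x hx
      exact hadj _ _ h5 (Finset.mem_Icc.1 hx).2 h6
    · intro x hx
      obtain ⟨h1, h2, -⟩ := hYlev x hx
      rw [hWY x hx, hWpar x (Finset.mem_filter.1 hx).1 (hops k (x + t) - 1) (by omega),
        ← pow_succ', show L - hops k (x + t) + 1 = L - (hops k (x + t) - 1) by omega]
    · omega
    · omega
  have hsplit : ∀ f : ℕ → ℝ, ∑ x ∈ Finset.Icc 1 N, f x = ∑ x ∈ Y, f x + ∑ x ∈ D, f x :=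
    fun f => (Finset.sum_filter_add_sum_filter_not _ _ _).symm
  rw [← Finset.sum_filter, hsplit]
  have hpow : ∀ h, h ≤ L → ((2 ^ (L - h) : ℕ) : ℝ) = 2 ^ L * (1 / 2) ^ h := by
    intro h hh
    push_cast
    rw [pow_sub₀ _ two_ne_zero hh, one_div, inv_pow]
  have main' : (∑ x ∈ Y, (C (v x) : ℝ) * (2 ^ L * (1 / 2) ^ hops k (x + t))) +
      ∑ x ∈ D, ((C (v x) / 2 : ℕ) : ℝ) * (2 ^ L * (2 * (1 / 2) ^ hops k (x + t))) ≤
      ∑ x ∈ Y, (2 ^ L * (1 / 2) ^ hops k (x + t)) := by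
    have h0 : ((∑ x ∈ Y, C (v x) * W x + ∑ x ∈ D, C (v x) / 2 * W (p x) : ℕ) : ℝ) ≤
      ((∑ x ∈ Y, W x : ℕ) : ℝ) := by exact_mod_cast main
    have e1 : ∀ x ∈ Y, (W x : ℝ) = 2 ^ L * (1 / 2) ^ hops k (x + t) := fun x hx => by
      rw [hWY x hx, hpow _ (hYlev x hx).2.1]
    have e2 : ∀ x ∈ D, (W (p x) : ℝ) = 2 ^ L * (2 * (1 / 2) ^ hops k (x + t)) := fun x hx => by
      have hx' := (Finset.mem_filter.1 hx).1
      obtain ⟨h, e, -, -, h3, -⟩ := hpar x hx'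
      rw [hWpar x hx' h e, hpow h h3, e, pow_succ]
      ring
    rw [Nat.cast_add, Nat.cast_sum, Nat.cast_sum, Nat.cast_sum, Finset.sum_congr rfl e1] at h0
    refine le_trans (le_of_eq ?_) h0
    congr 1
    · exact Finset.sum_congr rfl fun x hx => by rw [Nat.cast_mul, e1 x hx]
    · exact Finset.sum_congr rfl fun x hx => by rw [Nat.cast_mul, e2 x hx]
  have hYle : ∑ x ∈ Y, ((C (v x) - 1 : ℕ) : ℝ) * (1 / 2) ^ hops k (x + t) =
      ∑ x ∈ Y, (C (v x) : ℝ) * (1 / 2) ^ hops k (x + t) - ∑ x ∈ Y, (1 / 2) ^ hops k (x + t) +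
      ∑ x ∈ Y, if C (v x) = 0 then (1 / 2 : ℝ) ^ hops k (x + t) else 0 := by
    rw [← Finset.sum_sub_distrib, ← Finset.sum_add_distrib]
    refine Finset.sum_congr rfl fun x _ => ?_
    rcases Nat.eq_zero_or_pos (C (v x)) with h | h
    · simp [h]
    · rw [if_neg h.ne', Nat.cast_sub h]; push_cast; ring
  have hDle : ∑ x ∈ D, ((C (v x) - 1 : ℕ) : ℝ) * (1 / 2) ^ hops k (x + t) ≤
      ∑ x ∈ D, ((C (v x) / 2 : ℕ) : ℝ) * (2 * (1 / 2) ^ hops k (x + t)) := by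
    refine Finset.sum_le_sum fun x _ => ?_
    rw [← mul_assoc]
    refine mul_le_mul_of_nonneg_right ?_ (by positivity)
    exact_mod_cast (by omega : C (v x) - 1 ≤ C (v x) / 2 * 2)
  -- the common factor `2 ^ L` made the weights integers
  have hpos : (0 : ℝ) < 2 ^ L := by positivity
  simp only [mul_left_comm _ ((2 : ℝ) ^ L)] at main'
  rw [← Finset.mul_sum, ← Finset.mul_sum, ← Finset.mul_sum, ← mul_add,
    mul_le_mul_iff_right₀ hpos] at main'
  linarith

/-- The average of `sum_surplus_le_of_chain` over the `k` positions of the chain. -/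
theorem sum_surplus_le (hk : 0 < k) (hv : Set.InjOn v (Set.Iic N))
    (hadj : ∀ x y, x < y → y ≤ N → y ≤ x + k → G.Adj (v y) (v x)) {C : V → ℕ}
    (hC : ¬ Solves G (v 0) C) :
    ∑ x ∈ Finset.Icc 1 N, ((C (v x) - 1 : ℕ) : ℝ) *
        ∑ t ∈ Finset.range k, (1 / 2 : ℝ) ^ hops k (x + t) ≤
      ∑ x ∈ Finset.Icc 1 N, if C (v x) = 0 then (1 / 2 : ℝ) ^ hops k x else 0 := by
  have h := Finset.sum_le_sum fun t (ht : t ∈ Finset.range k) =>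
    sum_surplus_le_of_chain hk hv hadj hC (Finset.mem_range.1 ht)
  rw [Finset.sum_comm, Finset.sum_comm (s := Finset.range k)] at h
  simp only [← Finset.mul_sum] at h
  refine h.trans (Finset.sum_le_sum fun x hx => ?_)
  rw [Finset.mem_Icc] at hx
  obtain ⟨h, e, h1, h2⟩ := exists_hops_eq hk (show 0 < x by omega)
  rw [mul_add] at h2
  -- exactly one of the `k` chains passes through `x`
  rw [Finset.sum_eq_single (k * (h + 1) - x)]
  · have : x + (k * (h + 1) - x) = k * (h + 1) := by rw [mul_add]; omega
    rw [this, if_pos (dvd_mul_right _ _), hops_mul hk, e]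
  · intro t ht hne
    rw [Finset.mem_range] at ht
    rw [if_neg]
    rintro ⟨q, hq⟩
    have h3 : q = h + 1 := by
      have a1 : k * h < k * q := by omega
      have a2 : k * q < k * (h + 2) := by rw [mul_add]; omega
      have := Nat.lt_of_mul_lt_mul_left a1
      have := Nat.lt_of_mul_lt_mul_left a2
      omega
    subst h3
    omega
  · intro h3
    rw [Finset.mem_range, mul_add] at h3
    omega

end Line

/-- The weights of a position `x` seen from the two ends of a line of length `n` add up to at
least `1 / 2`: this is the inequality between the geometric and the arithmetic mean for `2 * k`
powers of `1 / 2`, whose exponents add up to `n + 2 * k - 2`. -/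
theorem half_le_sum_pow_hops {n k : ℕ} (hk : 0 < k) (hn : 2 ^ (n - 2) ≤ (2 * k) ^ (2 * k))
    {x y : ℕ} (hxy : x + y = n) :
    (1 / 2 : ℝ) ≤ ∑ t ∈ Finset.range k, (1 / 2 : ℝ) ^ hops k (x + t) +
      ∑ t ∈ Finset.range k, (1 / 2 : ℝ) ^ hops k (y + t) := by
  have hk' : (0 : ℝ) < k := by exact_mod_cast hk
  set E : ℝ := (n - 2) / (2 * k) + 1 with hE
  -- the tangent of `2 ^ (-s)` at the mean exponent `E`
  have tangent : ∀ j : ℕ,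
      Real.exp (-E * Real.log 2) * (1 - (j - E) * Real.log 2) ≤ (1 / 2 : ℝ) ^ j := by
    intro j
    have h1 : (1 / 2 : ℝ) ^ j = Real.exp (-E * Real.log 2) * Real.exp (-(j - E) * Real.log 2) := by
      rw [← Real.exp_add, show -E * Real.log 2 + -(j - E) * Real.log 2 = j * -Real.log 2 by ring,
        Real.exp_nat_mul, Real.exp_neg, Real.exp_log two_pos, one_div]
    rw [h1]
    refine mul_le_mul_of_nonneg_left ?_ (Real.exp_pos _).le
    have := Real.add_one_le_exp (-(j - E) * Real.log 2)
    linarith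
  have hsum : ∀ z : ℕ, Real.exp (-E * Real.log 2) * (k - (z + k - 1 - k * E) * Real.log 2) ≤
      ∑ t ∈ Finset.range k, (1 / 2 : ℝ) ^ hops k (z + t) := by
    intro z
    refine le_trans (le_of_eq ?_) (Finset.sum_le_sum fun t _ => tangent (hops k (z + t)))
    have h : (∑ t ∈ Finset.range k, (hops k (z + t) : ℝ)) + 1 = z + k := by
      exact_mod_cast sum_hops hk z
    rw [← Finset.mul_sum, Finset.sum_sub_distrib, ← Finset.sum_mul, Finset.sum_sub_distrib]
    simp only [Finset.sum_const, Finset.card_range, nsmul_eq_mul, mul_one]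
    rw [← h]
    ring
  have hlog : E * Real.log 2 ≤ Real.log (4 * k) := by
    have h1 : ((n - 2 : ℕ) : ℝ) * Real.log 2 ≤ 2 * k * Real.log (2 * k) := by
      have h2 : ((2 : ℝ)) ^ (n - 2) ≤ (2 * k) ^ (2 * k) := by exact_mod_cast hn
      have h3 := Real.log_le_log (by positivity) h2
      rw [Real.log_pow, Real.log_pow] at h3
      exact_mod_cast h3
    have h2 : (n : ℝ) - 2 ≤ ((n - 2 : ℕ) : ℝ) := by
      rw [sub_le_iff_le_add]
      exact_mod_cast (by omega : n ≤ n - 2 + 2)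
    have hlog2 := Real.log_pos one_lt_two
    have h3 : Real.log (4 * k) = Real.log (2 * k) + Real.log 2 := by
      rw [← Real.log_mul (by positivity) (by norm_num)]
      ring_nf
    have h4 : (n - 2) / (2 * k) * Real.log 2 ≤ Real.log (2 * k) := by
      rw [div_mul_eq_mul_div, div_le_iff₀ (by positivity)]
      nlinarith
    rw [h3, hE, add_mul, one_mul]
    linarith
  have hexp : (1 : ℝ) ≤ 4 * k * Real.exp (-E * Real.log 2) := by
    have h1 := Real.exp_le_exp.2 hlog
    rw [Real.exp_log (by positivity)] at h1
    rw [neg_mul, Real.exp_neg, ← div_eq_mul_inv, le_div_iff₀ (Real.exp_pos _)]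
    linarith
  have hx := hsum x
  have hy := hsum y
  have hE' : 2 * k * E = n - 2 + 2 * k := by rw [hE]; field_simp
  have hn' : (n : ℝ) = x + y := by exact_mod_cast hxy.symm
  have : Real.exp (-E * Real.log 2) * (k - (x + k - 1 - k * E) * Real.log 2) +
      Real.exp (-E * Real.log 2) * (k - (y + k - 1 - k * E) * Real.log 2) =
      2 * k * Real.exp (-E * Real.log 2) := by
    rw [← mul_add, show (k : ℝ) - (x + k - 1 - k * E) * Real.log 2 +
      (k - (y + k - 1 - k * E) * Real.log 2) = 2 * k - (x + y - 2 + 2 * k - 2 * k * E) * Real.log 2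
      by ring, hE', hn']
    ring
  linarith

/-! ### Powers of cycles that are Class 0 -/

section ClassZero

variable {V : Type*} {G : SimpleGraph V}

theorem not_solves_of_forall_not_step {r : V} {C : V → ℕ} (h : ∀ D, ¬ Step G C D)
    (hr : C r = 0) : ¬ Solves G r C := by
  rintro ⟨D, hD, hDr⟩
  rcases hD.cases_head with rfl | ⟨E, hE, -⟩
  · omega
  · exact h E hE

variable [Fintype V]

/-- The configurations with at most one pebble on every vertex and none on the root show that the
pebbling number is at least the number of vertices. -/
theorem card_le_pebblingNumber [Nonempty V] : (Fintype.card V : ℕ∞) ≤ pebblingNumber G := by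
  classical
  obtain ⟨r⟩ := ‹Nonempty V›
  refine le_trans ?_ (le_iSup _ r)
  refine le_iInf₂ fun t ht => ?_
  by_contra! hlt
  have hlt : t < Fintype.card V := by exact_mod_cast hlt
  obtain ⟨s, hs, hcard⟩ := Finset.exists_subset_card_eq (s := Finset.univ.erase r) (n := t)
    (by rw [Finset.card_erase_of_mem (Finset.mem_univ _), Finset.card_univ]; omega)
  refine not_solves_of_forall_not_step (G := G) (r := r) (C := fun x => if x ∈ s then 1 else 0)
    ?_ ?_ (ht _ (by simp [hcard]))
  · rintro D ⟨u, v, -, hu, -⟩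
    dsimp only at hu
    split_ifs at hu
    all_goals omega
  · have : r ∉ s := fun h => by simpa using hs h
    simp [this]

theorem isClassZero_of_forall_solves [Nonempty V]
    (h : ∀ r (C : V → ℕ), ∑ v, C v = Fintype.card V → Solves G r C) : IsClassZero G := by
  refine le_antisymm (iSup_le fun r => ?_) card_le_pebblingNumber
  exact iInf₂_le _ fun C hC => h r C hC

theorem not_isClassZero_of_unsolvable (r : V)
    (h : ∀ t ≤ Fintype.card V, ∃ C : V → ℕ, ∑ v, C v = t ∧ ¬ Solves G r C) :
    ¬ IsClassZero G := by
  intro h0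
  have h1 : ((Fintype.card V + 1 : ℕ) : ℕ∞) ≤ pebblingNumber G := by
    refine le_trans ?_ (le_iSup (rootedPebblingNumber G) r)
    refine le_iInf₂ fun t ht => ?_
    by_contra! hlt
    have hlt : t < Fintype.card V + 1 := by exact_mod_cast hlt
    obtain ⟨C, hC, hs⟩ := h t (by omega)
    exact hs (ht C hC)
  rw [h0] at h1
  have : Fintype.card V + 1 ≤ Fintype.card V := by exact_mod_cast h1
  omega

end ClassZero

section Cycle

variable {n k : ℕ}

/-- The vertex of the cycle that is reached from `r` by `p` steps in the positive direction. -/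
def pos (r : Fin n) (p : ℕ) : Fin n :=
  ⟨(r + p) % n, Nat.mod_lt _ r.pos⟩

theorem pos_zero (r : Fin n) : pos r 0 = r := by
  ext; simp [pos, Nat.mod_eq_of_lt r.2]

theorem pos_self (r : Fin n) : pos r n = r := by
  ext; simp [pos, Nat.mod_eq_of_lt r.2]

theorem eq_of_pos_eq {r : Fin n} {p q : ℕ} (h : pos r p = pos r q) (h1 : p ≤ q) (h2 : q < p + n) :
    p = q := by
  have h : (r + p) ≡ (r + q) [MOD n] := congrArg Fin.val h
  have h := (Nat.modEq_iff_dvd' h1).1 (Nat.ModEq.add_left_cancel' _ h)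
  have := Nat.eq_zero_of_dvd_of_lt h (by omega)
  omega

theorem cycleGraph_adj_pos_succ (hn : 2 ≤ n) (r : Fin n) (p : ℕ) :
    (SimpleGraph.cycleGraph n).Adj (pos r p) (pos r (p + 1)) := by
  rw [SimpleGraph.cycleGraph_adj']
  right
  rw [Fin.val_sub]
  simp only [pos]
  have h1 : (r + (p + 1)) % n = ((r + p) % n + 1) % n := by rw [Nat.mod_add_mod, add_assoc]
  have h2 := Nat.mod_lt (r + p : ℕ) (show 0 < n by omega)
  rw [h1, Nat.add_mod_mod,
    show n - (r + p : ℕ) % n + ((r + p : ℕ) % n + 1) = 1 + n by omega, Nat.add_mod_right,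
    Nat.mod_eq_of_lt (by omega)]

theorem edist_pos_le (hn : 2 ≤ n) (r : Fin n) (p i : ℕ) :
    (SimpleGraph.cycleGraph n).edist (pos r p) (pos r (p + i)) ≤ i := by
  induction i with
  | zero => simp
  | succ i ih =>
    refine (SimpleGraph.edist_triangle (v := pos r (p + i))).trans ?_
    push_cast
    exact add_le_add ih
      (SimpleGraph.edist_eq_one_iff_adj.2 (cycleGraph_adj_pos_succ hn r (p + i))).le

theorem graphPower_adj_pos (hn : 2 ≤ n) (r : Fin n) {p q : ℕ} (h1 : p < q) (h2 : q < p + n)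
    (h3 : q ≤ p + k) : (graphPower (SimpleGraph.cycleGraph n) k).Adj (pos r p) (pos r q) := by
  refine ⟨fun h => ?_, ?_⟩
  · have := eq_of_pos_eq h h1.le h2
    omega
  · obtain ⟨i, rfl⟩ := Nat.exists_eq_add_of_le h1.le
    refine (edist_pos_le hn r p i).trans ?_
    exact_mod_cast (by omega : i ≤ k)

theorem sum_eq_sum_pos (r : Fin n) (f : Fin n → ℕ) :
    ∑ x, f x = f r + ∑ p ∈ Finset.Icc 1 (n - 1), f (pos r p) := by
  have hn : 0 < n := r.pos
  have hinj : Set.InjOn (pos r) (Finset.range n : Finset ℕ) := by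
    intro p hp q hq h
    simp only [Finset.coe_range, Set.mem_Iio] at hp hq
    rcases le_total p q with h1 | h1
    · exact eq_of_pos_eq h h1 (by omega)
    · exact (eq_of_pos_eq h.symm h1 (by omega)).symm
  have himage : (Finset.range n).image (pos r) = Finset.univ := by
    rw [← Finset.card_eq_iff_eq_univ, Finset.card_image_of_injOn hinj, Finset.card_range,
      Fintype.card_fin]
  rw [← himage, Finset.sum_image hinj, ← Finset.add_sum_erase _ _ (Finset.mem_range.2 hn), pos_zero]
  congr 1
  refine Finset.sum_congr ?_ fun _ _ => rfl
  ext p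
  simp only [Finset.mem_erase, Finset.mem_range, Finset.mem_Icc]
  omega

/-- The two averaged weight arguments, one on each side of the root, combined: `c x` is the number
of pebbles at position `x` of a line of length `n` whose two ends are both the root. The total
surplus is at most the number of empty positions. -/
theorem sum_surplus_le_card_empty {c : ℕ → ℕ} (hk : 0 < k)
    (h : 2 ^ (n - 2) ≤ (2 * k) ^ (2 * k))
    (hnear : ∀ p ∈ Finset.Icc 1 (n - 1), 2 ≤ c p → p ≤ n - 1 - k ∧ k < p)
    (hright : ∑ x ∈ Finset.Icc 1 (n - 1 - k), ((c x - 1 : ℕ) : ℝ) *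
        ∑ t ∈ Finset.range k, (1 / 2 : ℝ) ^ hops k (x + t) ≤
      ∑ x ∈ Finset.Icc 1 (n - 1 - k), if c x = 0 then (1 / 2 : ℝ) ^ hops k x else 0)
    (hleft : ∑ x ∈ Finset.Icc 1 (n - 1 - k), ((c (n - x) - 1 : ℕ) : ℝ) *
        ∑ t ∈ Finset.range k, (1 / 2 : ℝ) ^ hops k (x + t) ≤
      ∑ x ∈ Finset.Icc 1 (n - 1 - k), if c (n - x) = 0 then (1 / 2 : ℝ) ^ hops k x else 0) :
    ∑ x ∈ Finset.Icc 1 (n - 1), (c x - 1) ≤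
      ∑ x ∈ Finset.Icc 1 (n - 1), if c x = 0 then 1 else 0 := by
  generalize hN : n - 1 - k = N at *
  -- both inequalities as sums over all positions
  have extR : ∀ f : ℕ → ℝ, ∑ x ∈ Finset.Icc 1 N, f x =
      ∑ x ∈ Finset.Icc 1 (n - 1), if x ≤ N then f x else 0 := by
    intro f
    rw [← Finset.sum_filter]
    refine Finset.sum_congr ?_ fun _ _ => rfl
    ext x
    simp only [Finset.mem_filter, Finset.mem_Icc]
    omega
  have extL : ∀ f : ℕ → ℝ, ∑ x ∈ Finset.Icc 1 N, f x =
      ∑ x ∈ Finset.Icc 1 (n - 1), if k < x then f (n - x) else 0 := by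
    intro f
    rw [← Finset.sum_filter]
    refine Finset.sum_nbij' (fun x => n - x) (fun x => n - x) ?_ ?_ ?_ ?_ ?_
    · intro x hx
      simp only [Finset.mem_filter, Finset.mem_Icc] at hx ⊢
      omega
    · intro x hx
      simp only [Finset.mem_filter, Finset.mem_Icc] at hx ⊢
      omega
    · intro x hx
      simp only [Finset.mem_Icc] at hx
      omega
    · intro x hx
      simp only [Finset.mem_filter, Finset.mem_Icc] at hx
      omega
    · intro x hx
      simp only [Finset.mem_Icc] at hx
      rw [show n - (n - x) = x by omega]
  rw [extR, extR] at hright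
  rw [extL, extL] at hleft
  have hsum := add_le_add hright hleft
  rw [← Finset.sum_add_distrib, ← Finset.sum_add_distrib] at hsum
  have hlower : ∀ x ∈ Finset.Icc 1 (n - 1), ((c x - 1 : ℕ) : ℝ) * (1 / 2) ≤
      (if x ≤ N then ((c x - 1 : ℕ) : ℝ) *
        ∑ t ∈ Finset.range k, (1 / 2 : ℝ) ^ hops k (x + t) else 0) +
      (if k < x then ((c (n - (n - x)) - 1 : ℕ) : ℝ) *
        ∑ t ∈ Finset.range k, (1 / 2 : ℝ) ^ hops k (n - x + t) else 0) := by
    intro x hx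
    by_cases h2 : 2 ≤ c x
    · obtain ⟨h3, h4⟩ := hnear x hx h2
      rw [Finset.mem_Icc] at hx
      rw [if_pos h3, if_pos h4, show n - (n - x) = x by omega, ← mul_add]
      exact mul_le_mul_of_nonneg_left
        (half_le_sum_pow_hops hk h (by omega)) (Nat.cast_nonneg _)
    · rw [show c x - 1 = 0 by omega]
      simp only [Nat.cast_zero, zero_mul]
      positivity
  have hupper : ∀ x ∈ Finset.Icc 1 (n - 1),
      (if x ≤ N then (if c x = 0 then (1 / 2 : ℝ) ^ hops k x else 0) else 0) +
      (if k < x then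
        (if c (n - (n - x)) = 0 then (1 / 2 : ℝ) ^ hops k (n - x) else 0) else 0) ≤
      (if c x = 0 then 1 else 0) * (1 / 2) := by
    intro x hx
    rw [Finset.mem_Icc] at hx
    rw [show n - (n - x) = x by omega]
    by_cases h0 : c x = 0
    · have pow1 : ∀ {y}, 1 ≤ hops k y → (1 / 2 : ℝ) ^ hops k y ≤ 1 / 2 := fun hy => by
        simpa using pow_le_pow_of_le_one (by norm_num : (0 : ℝ) ≤ 1 / 2) (by norm_num) hy
      have pow2 : ∀ {y}, 2 ≤ hops k y → (1 / 2 : ℝ) ^ hops k y ≤ (1 / 2) ^ 2 := fun hy =>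
        pow_le_pow_of_le_one (by norm_num : (0 : ℝ) ≤ 1 / 2) (by norm_num) hy
      simp only [h0, if_true]
      by_cases h1 : x ≤ N <;> by_cases h2 : k < x
      · rw [if_pos h1, if_pos h2]
        have a1 := pow2 (two_le_hops hk h2)
        have a2 := pow2 (two_le_hops hk (show k < n - x by omega))
        norm_num at a1 a2 ⊢
        linarith
      · rw [if_pos h1, if_neg h2]
        have := pow1 (one_le_hops hk (show 0 < x by omega))
        linarith
      · rw [if_neg h1, if_pos h2]
        have := pow1 (one_le_hops hk (show 0 < n - x by omega))
        linarith
      · rw [if_neg h1, if_neg h2]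
        norm_num
    · simp [h0]
  have hfinal := (Finset.sum_le_sum hlower).trans (hsum.trans (Finset.sum_le_sum hupper))
  rw [← Finset.sum_mul, ← Finset.sum_mul, mul_le_mul_iff_left₀ (by norm_num)] at hfinal
  exact_mod_cast hfinal

/-- The lower bound `2 ^ (n - 2) ≤ (2 * k) ^ (2 * k)` for `k` is what the two averaged weight
arguments, one on each side of the root, require. -/
theorem isClassZero_graphPower_cycleGraph (hn : 2 ≤ n) (hk : 0 < k)
    (h : 2 ^ (n - 2) ≤ (2 * k) ^ (2 * k)) :
    IsClassZero (graphPower (SimpleGraph.cycleGraph n) k) := by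
  have : Nonempty (Fin n) := ⟨⟨0, by omega⟩⟩
  refine isClassZero_of_forall_solves fun r C hC => ?_
  by_contra hsolve
  rw [Fintype.card_fin, sum_eq_sum_pos r] at hC
  have hr : C r = 0 := by
    by_contra h0
    exact hsolve (.of_one_le (by omega))
  -- a neighbour of the root has at most one pebble
  have hnear : ∀ p ∈ Finset.Icc 1 (n - 1), 2 ≤ C (pos r p) → p ≤ n - 1 - k ∧ k < p := by
    intro p hp h2
    rw [Finset.mem_Icc] at hp
    by_contra hcon
    rcases (show p ≤ k ∨ n ≤ p + k by omega) with h3 | h3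
    · refine hsolve (.of_adj_of_two_le (G := graphPower (SimpleGraph.cycleGraph n) k) ?_ h2)
      have := graphPower_adj_pos (k := k) hn r (p := 0) (q := p) (by omega) (by omega) (by omega)
      rw [pos_zero] at this
      exact this.symm
    · refine hsolve (.of_adj_of_two_le (G := graphPower (SimpleGraph.cycleGraph n) k) ?_ h2)
      have := graphPower_adj_pos (k := k) hn r (p := p) (q := n) (by omega) (by omega) (by omega)
      rwa [pos_self] at this
  have hright := sum_surplus_le (G := graphPower (SimpleGraph.cycleGraph n) k) (v := pos r)
    (N := n - 1 - k) (C := C) hk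
    (by
      intro p hp q hq e
      simp only [Set.mem_Iic] at hp hq
      rcases le_total p q with h1 | h1
      · exact eq_of_pos_eq e h1 (by omega)
      · exact (eq_of_pos_eq e.symm h1 (by omega)).symm)
    (fun x y h1 h2 h3 => (graphPower_adj_pos hn r h1 (by omega) h3).symm)
    (by rwa [pos_zero])
  have hleft := sum_surplus_le (G := graphPower (SimpleGraph.cycleGraph n) k)
    (v := fun p => pos r (n - p)) (N := n - 1 - k) (C := C) hk
    (by
      intro p hp q hq e
      simp only [Set.mem_Iic] at hp hq
      rcases le_total p q with h1 | h1
      · have := eq_of_pos_eq e.symm (by omega) (by omega); omega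
      · have := eq_of_pos_eq e (by omega) (by omega); omega)
    (fun x y h1 h2 h3 => graphPower_adj_pos hn r (by omega) (by omega) (by omega))
    (by simpa only [Nat.sub_zero, pos_self] using hsolve)
  have hfinal' : ∑ x ∈ Finset.Icc 1 (n - 1), (C (pos r x) - 1) ≤
      ∑ x ∈ Finset.Icc 1 (n - 1), if C (pos r x) = 0 then 1 else 0 := by
    exact sum_surplus_le_card_empty (c := fun p => C (pos r p)) hk h hnear hright hleft
  -- there are `n` pebbles on the `n - 1` vertices other than the root
  have hcount : ∑ x ∈ Finset.Icc 1 (n - 1), (C (pos r x) - 1) + ∑ x ∈ Finset.Icc 1 (n - 1), 1 =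
      ∑ x ∈ Finset.Icc 1 (n - 1), C (pos r x) +
        ∑ x ∈ Finset.Icc 1 (n - 1), if C (pos r x) = 0 then 1 else 0 := by
    rw [← Finset.sum_add_distrib, ← Finset.sum_add_distrib]
    refine Finset.sum_congr rfl fun x _ => ?_
    split_ifs <;> omega
  rw [Finset.sum_const, Nat.card_Icc, smul_eq_mul, mul_one] at hcount
  omega

end Cycle

/-! ### Powers of cycles that are not Class 0 -/

section LowerBound

/-- If the target of a step has at most twice the weight of its source, the step does not increase
the total weight. -/
theorem sum_mul_le_of_step {V : Type*} [Fintype V] {C D : V → ℕ} {u v : V}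
    (hne : u ≠ v) (hu : C u = D u + 2) (hv : D v = C v + 1)
    (hother : ∀ w, w ≠ u → w ≠ v → D w = C w) {w : V → ℝ} (hw : w v ≤ 2 * w u) :
    ∑ x, (D x : ℝ) * w x ≤ ∑ x, (C x : ℝ) * w x := by
  classical
  have key : ∀ x, (D x : ℝ) * w x + (if x = u then 2 * w x else 0) =
      C x * w x + (if x = v then w x else 0) := by
    intro x
    by_cases h1 : x = u
    · subst h1; simp [hne, hu]; ring
    by_cases h2 : x = v
    · subst h2; simp [h1, hv]; ring
    · simp [h1, h2, hother x h1 h2]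
  have := Finset.sum_congr (rfl : (Finset.univ : Finset V) = Finset.univ) fun x _ => key x
  simp only [Finset.sum_add_distrib, Finset.sum_ite_eq', Finset.mem_univ, if_true] at this
  linarith

variable {n k : ℕ}

/-- A walk of length `l` in the cycle joins vertices which differ, modulo `n`, by an integer of
absolute value at most `l`. -/
theorem exists_int_of_walk {u v : Fin n} (p : (SimpleGraph.cycleGraph n).Walk u v) :
    ∃ z : ℤ, |z| ≤ p.length ∧ (n : ℤ) ∣ v - u - z := by
  induction p with
  | nil => exact ⟨0, by simp⟩
  | @cons u v w h p ih =>
    obtain ⟨z, hz, hd⟩ := ih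
    rw [SimpleGraph.cycleGraph_adj'] at h
    have hmod : ∀ a b : Fin n, (a - b).val = 1 → (n : ℤ) ∣ a - b - 1 := by
      intro a b hab
      rw [Fin.val_sub] at hab
      have h1 : ((1 : ℕ) : ℤ) = (n - b + a : ℕ) % n := by
        rw [← hab]; push_cast; rfl
      have h2 := Int.dvd_sub_self_of_emod_eq h1.symm
      rw [Nat.cast_add, Nat.cast_sub b.2.le] at h2
      obtain ⟨c, hc⟩ := h2
      refine ⟨-c - 1, ?_⟩
      push_cast at hc
      linear_combination -hc
    rw [SimpleGraph.Walk.length_cons]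
    rcases h with h | h
    · refine ⟨z - 1, ?_, ?_⟩
      · push_cast; rw [abs_le] at hz ⊢; constructor <;> linarith
      · obtain ⟨c, hc⟩ := hmod _ _ h
        obtain ⟨e, he⟩ := hd
        exact ⟨e - c, by linear_combination he - hc⟩
    · refine ⟨z + 1, ?_, ?_⟩
      · push_cast; rw [abs_le] at hz ⊢; constructor <;> linarith
      · obtain ⟨c, hc⟩ := hmod _ _ h
        obtain ⟨e, he⟩ := hd
        exact ⟨e + c, by linear_combination he + hc⟩

theorem exists_int_of_graphPower_adj {u v : Fin n}
    (h : (graphPower (SimpleGraph.cycleGraph n) k).Adj u v) :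
    ∃ z : ℤ, |z| ≤ k ∧ (n : ℤ) ∣ v - u - z := by
  obtain ⟨p, hp⟩ := SimpleGraph.exists_walk_of_edist_ne_top
    (ne_top_of_le_ne_top (ENat.natCast_ne_top k) h.2)
  obtain ⟨z, hz, hd⟩ := exists_int_of_walk p
  refine ⟨z, hz.trans ?_, hd⟩
  have := h.2
  rw [← hp] at this
  exact_mod_cast this

/-- A vertex of the cycle that is not adjacent to the root `0` in the power of the cycle cannot
jump over the root. -/
theorem val_near_of_adj {u v : Fin n}
    (h : (graphPower (SimpleGraph.cycleGraph n) k).Adj u v) (h1 : k < u.val)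
    (h2 : u.val + k < n) : 0 < v.val ∧ v.val ≤ u + k ∧ u.val ≤ v + k := by
  obtain ⟨z, hz, hd⟩ := exists_int_of_graphPower_adj h
  rw [abs_le] at hz
  have : (v : ℤ) - u - z = 0 := by
    refine Int.eq_zero_of_abs_lt_dvd hd ?_
    have := v.2
    rw [abs_lt]
    constructor <;> omega
  omega

theorem half_pow_hops_le {x y : ℕ} (hk : 0 < k) (h : x ≤ y + k) :
    (1 / 2 : ℝ) ^ hops k y ≤ 2 * (1 / 2) ^ hops k x := by
  have h1 := (hops_mono (k := k) h).trans_eq (hops_add_self hk)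
  have h2 := pow_le_pow_of_le_one (by norm_num : (0 : ℝ) ≤ 1 / 2) (by norm_num) h1
  rw [pow_succ] at h2
  linarith

/-- If the weight of a configuration is less than `1` both in terms of the jumps needed to reach
the root `0` in the negative direction and in terms of those needed in the positive direction, then
the root cannot be solved. -/
theorem not_solves_of_weight_lt (hk : 0 < k) {r : Fin n} (hr : r.val = 0) {C : Fin n → ℕ}
    (hC : C r = 0) (h1 : ∑ x, (C x : ℝ) * (1 / 2) ^ hops k x < 1)
    (h2 : ∑ x, (C x : ℝ) * (1 / 2) ^ hops k (n - x) < 1) :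
    ¬ Solves (graphPower (SimpleGraph.cycleGraph n) k) r C := by
  rintro ⟨D, hD, hDr⟩
  have inv : D r = 0 ∧ ∑ x, (D x : ℝ) * (1 / 2) ^ hops k x < 1 ∧
      ∑ x, (D x : ℝ) * (1 / 2) ^ hops k (n - x) < 1 := by
    clear hDr
    induction hD with
    | refl => exact ⟨hC, h1, h2⟩
    | @tail D E _ hstep ih =>
      obtain ⟨i0, i1, i2⟩ := ih
      obtain ⟨u, v, hadj, hu, hv, hother⟩ := hstep
      have hur : u.val ≠ 0 := by
        intro h
        have : u = r := Fin.ext (by omega)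
        rw [this] at hu
        omega
      -- two pebbles on a vertex at distance one from the root have weight one
      have far : ∀ d : Fin n → ℕ, ∑ x, (D x : ℝ) * (1 / 2) ^ hops k (d x) < 1 → k < d u := by
        intro d hd
        by_contra! hcon
        have e1 : (D u : ℝ) * (1 / 2) ^ hops k (d u) ≤ ∑ x, (D x : ℝ) * (1 / 2) ^ hops k (d x) :=
          Finset.single_le_sum (f := fun x => (D x : ℝ) * (1 / 2) ^ hops k (d x))
            (fun _ _ => by positivity) (Finset.mem_univ u)
        have e2 : (1 / 2 : ℝ) ^ 1 ≤ (1 / 2 : ℝ) ^ hops k (d u) :=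
          pow_le_pow_of_le_one (by norm_num) (by norm_num) (hops_le_one hk hcon)
        have e3 : (2 : ℝ) ≤ D u := by exact_mod_cast (by omega : 2 ≤ D u)
        have e4 : (2 : ℝ) * (1 / 2) ^ 1 ≤ D u * (1 / 2) ^ hops k (d u) := by gcongr
        norm_num at e4
        norm_num at e1 hd
        linarith
      have f1 := far (fun x => x) i1
      have f2 := far (fun x => n - x) i2
      obtain ⟨g0, g1, g2⟩ := val_near_of_adj hadj f1 (by omega)
      have hne : u ≠ v := hadj.1
      refine ⟨?_, ?_, ?_⟩
      · rw [hother r (fun h => hur (by rw [← h, hr])) (fun h => by rw [← h, hr] at g0; omega), i0]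
      · exact (sum_mul_le_of_step hne hu hv hother (w := fun x => (1 / 2) ^ hops k x)
          (half_pow_hops_le hk g2)).trans_lt i1
      · exact (sum_mul_le_of_step hne hu hv hother (w := fun x => (1 / 2) ^ hops k (n - x))
          (half_pow_hops_le hk (by omega))).trans_lt i2
  omega

/-- Two piles of `A` and `B` pebbles that do not solve the root refute Class 0 as soon as they have
`n` pebbles together. -/
theorem not_isClassZero_of_two_piles (hk : 0 < k) {x y A B : ℕ} (hx : 0 < x) (hxn : x < n)
    (hy : 0 < y) (hyn : y < n) (hAB : n ≤ A + B)
    (h1 : (A : ℝ) * (1 / 2) ^ hops k x + B * (1 / 2) ^ hops k y < 1)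
    (h2 : (A : ℝ) * (1 / 2) ^ hops k (n - x) + B * (1 / 2) ^ hops k (n - y) < 1) :
    ¬ IsClassZero (graphPower (SimpleGraph.cycleGraph n) k) := by
  refine not_isClassZero_of_unsolvable ⟨0, by omega⟩ fun t ht => ?_
  rw [Fintype.card_fin] at ht
  obtain ⟨a, b, ha, hb, rfl⟩ : ∃ a b, a ≤ A ∧ b ≤ B ∧ a + b = t :=
    ⟨min t A, t - min t A, by omega, by omega, by omega⟩
  have hsum : ∀ w : Fin n → ℝ, ∑ z : Fin n, (((if z = ⟨x, hxn⟩ then a else 0) +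
      (if z = ⟨y, hyn⟩ then b else 0) : ℕ) : ℝ) * w z = a * w ⟨x, hxn⟩ + b * w ⟨y, hyn⟩ := by
    intro w
    push_cast
    simp only [add_mul, Finset.sum_add_distrib, ite_mul, zero_mul, Finset.sum_ite_eq',
      Finset.mem_univ, if_true]
  refine ⟨fun z => (if z = ⟨x, hxn⟩ then a else 0) + (if z = ⟨y, hyn⟩ then b else 0), ?_, ?_⟩
  · simp [Finset.sum_add_distrib]
  · refine not_solves_of_weight_lt hk rfl ?_ ?_ ?_
    · simp [Fin.ext_iff, hx.ne, hy.ne]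
    · rw [hsum (fun z => (1 / 2) ^ hops k z)]
      refine lt_of_le_of_lt ?_ h1
      dsimp only
      gcongr
    · rw [hsum (fun z => (1 / 2) ^ hops k (n - z))]
      refine lt_of_le_of_lt ?_ h2
      dsimp only
      gcongr

theorem not_isClassZero_of_one_pile (hk : 0 < k) {x d : ℕ} (hx : 0 < x) (hxn : x < n)
    (h1 : d ≤ hops k x) (h2 : d ≤ hops k (n - x)) (hd : n < 2 ^ d) :
    ¬ IsClassZero (graphPower (SimpleGraph.cycleGraph n) k) := by
  have key : ∀ e, d ≤ e → (n : ℝ) * (1 / 2) ^ e + (0 : ℕ) * (1 / 2) ^ e < 1 := by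
    intro e he
    have h3 : (n : ℝ) < 2 ^ e := by exact_mod_cast hd.trans_le (Nat.pow_le_pow_right two_pos he)
    rw [Nat.cast_zero, zero_mul, add_zero, one_div, inv_pow, ← div_eq_mul_inv,
      div_lt_one (by positivity)]
    exact h3
  exact not_isClassZero_of_two_piles hk hx hxn hx hxn (A := n) (B := 0) (by omega)
    (key _ h1) (key _ h2)

/-- The arithmetic of the configuration with two equal piles of `2 ^ (d + 1) / 3` pebbles. The
exception is the cycle of length `5`. -/
theorem le_two_mul_div_three {n k d : ℕ} (hk : 0 < k) (hd : 0 < d) (hn : n = 2 * (k * d) + 1)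
    (h5 : n ≠ 5) (h : n ^ (2 * k) < 2 ^ n) : n ≤ 2 * (2 ^ (d + 1) / 3) := by
  by_contra! hcon
  set P := 2 ^ d with hP
  rw [pow_succ, ← hP] at hcon
  have h3 : 4 * P ≤ 3 * n + 1 := by omega
  have hP1 : 2 ≤ P := by simpa [hP] using Nat.pow_le_pow_right two_pos hd
  have hpow : n ^ (2 * k) < 2 * P ^ (2 * k) := by
    refine h.trans_eq ?_
    rw [hP, ← pow_mul, ← pow_succ', hn]
    congr 1
    ring
  obtain rfl | hk2 := (show k = 1 ∨ 2 ≤ k by omega)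
  · have h6 : d ≤ 2 := by
      by_contra! hd3
      have : ∀ e, 2 * (e + 3) + 2 ≤ 2 ^ (e + 3) := by
        intro e
        induction e with
        | zero => norm_num
        | succ e ih => rw [show e + 1 + 3 = e + 3 + 1 by ring, pow_succ]; omega
      have := this (d - 3)
      rw [Nat.sub_add_cancel hd3] at this
      omega
    interval_cases d
    · norm_num [hP] at hpow
      subst hn
      norm_num at hpow
    · omega
  · have h4 : n ^ 4 < 2 * P ^ 4 := by
      by_contra! hge
      obtain ⟨j, hj⟩ := Nat.exists_eq_add_of_le (show 4 ≤ 2 * k by omega)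
      rw [hj, pow_add, pow_add, ← mul_assoc] at hpow
      exact absurd hpow (not_lt.2 (Nat.mul_le_mul hge (Nat.pow_le_pow_left (by omega) j)))
    obtain rfl | hd2 := (show d = 1 ∨ 2 ≤ d by omega)
    · have : 5 ^ 4 ≤ n ^ 4 := Nat.pow_le_pow_left (by omega) 4
      norm_num [hP] at h4
      omega
    · have hP4 : 4 ≤ P := by simpa [hP] using Nat.pow_le_pow_right two_pos hd2
      have h6 : (15 * P) ^ 4 ≤ (12 * n) ^ 4 := Nat.pow_le_pow_left (by omega) 4
      rw [mul_pow, mul_pow] at h6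
      have : 0 < P ^ 4 := by positivity
      omega

/-- A power of the cycle with `n ^ (2 * k) < 2 ^ n` is not Class 0: on even cycles a pile on the
vertex opposite to the root is unsolvable. On odd cycles, so is a pile on one of the two
vertices opposite to the root, unless `k` divides `(n - 1) / 2`; then two equal piles on both of
them are used. -/
theorem not_isClassZero_graphPower_cycleGraph (hn : 3 ≤ n) (h5 : n ≠ 5) (hk : 0 < k)
    (h : n ^ (2 * k) < 2 ^ n) : ¬ IsClassZero (graphPower (SimpleGraph.cycleGraph n) k) := by
  have hbig : ∀ d, n ≤ 2 * (k * d) → n < 2 ^ d := by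
    intro d hd
    refine lt_of_pow_lt_pow_left₀ (2 * k) (Nat.zero_le _) (h.trans_le ?_)
    rw [← pow_mul]
    exact Nat.pow_le_pow_right two_pos (by rw [mul_comm d]; linarith)
  obtain ⟨m, hm | hm⟩ := Nat.even_or_odd' n
  · obtain ⟨d, hd, -, hle⟩ := exists_hops_eq hk (show 0 < m by omega)
    exact not_isClassZero_of_one_pile hk (x := m) (d := d + 1) (by omega) (by omega) hd.ge
      (by rw [show n - m = m by omega]; exact hd.ge) (hbig _ (by omega))
  · obtain ⟨d, hd, hlt, hle⟩ := exists_hops_eq hk (show 0 < m by omega)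
    rcases Nat.lt_or_ge m (k * (d + 1)) with hlt' | hge
    · exact not_isClassZero_of_one_pile hk (x := m) (d := d + 1) (by omega) (by omega) hd.ge
        (hd.ge.trans (hops_mono (by omega))) (hbig _ (by omega))
    · have hmk : m = k * (d + 1) := le_antisymm hle hge
      have hd' : hops k (m + 1) = d + 1 + 1 :=
        (hops_eq_iff hk (by omega)).2 ⟨by omega, by rw [hmk, mul_add _ (d + 1)]; omega⟩
      have hA := le_two_mul_div_three (n := n) hk (Nat.succ_pos d) (by rw [hm, hmk]) h5 h
      have hA3 : 3 * (2 ^ (d + 1 + 1) / 3) < 2 ^ (d + 1 + 1) := by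
        have hnd : ¬ 3 ∣ 2 ^ (d + 1 + 1) := fun h =>
          absurd (Nat.prime_three.dvd_of_dvd_pow h) (by norm_num)
        omega
      have key : ((2 ^ (d + 1 + 1) / 3 : ℕ) : ℝ) * (1 / 2) ^ (d + 1) +
          ((2 ^ (d + 1 + 1) / 3 : ℕ) : ℝ) * (1 / 2) ^ (d + 1 + 1) < 1 := by
        have h1 : 3 * ((2 ^ (d + 1 + 1) / 3 : ℕ) : ℝ) < 2 ^ (d + 1 + 1) := by exact_mod_cast hA3
        generalize ((2 ^ (d + 1 + 1) / 3 : ℕ) : ℝ) = X at h1 ⊢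
        have h2 := (div_lt_one (by positivity)).2 h1
        rw [div_eq_mul_inv, ← inv_pow, pow_succ _ (d + 1)] at h2
        rw [one_div, pow_succ _ (d + 1)]
        linarith
      refine not_isClassZero_of_two_piles hk (x := m) (y := m + 1) (A := 2 ^ (d + 1 + 1) / 3)
        (B := 2 ^ (d + 1 + 1) / 3) (by omega) (by omega) (by omega) (by omega) (by omega) ?_ ?_
      · rw [hd, hd']
        exact key
      · rw [show n - m = m + 1 by omega, show n - (m + 1) = m by omega, hd, hd', add_comm]
        exact key

theorem not_isClassZero_graphPower_zero {V : Type*} [Fintype V] [Nontrivial V] (G : SimpleGraph V) :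
    ¬ IsClassZero (graphPower G 0) := by
  classical
  obtain ⟨r, s, hrs⟩ := exists_pair_ne V
  refine not_isClassZero_of_unsolvable r fun t _ =>
    ⟨fun x => if x = s then t else 0, by simp, not_solves_of_forall_not_step ?_ (by simp [hrs])⟩
  rintro D ⟨u, v, ⟨hne, h⟩, -⟩
  exact hne (by simpa using h)

end LowerBound

/-! ### The numerical bounds -/

section Bounds

open Real

theorem logb_logb_lt_logb {n : ℕ} (hn : 2 ≤ n) : logb 2 (logb 2 n) < logb 2 n := by
  have hn' : (2 : ℝ) ≤ n := by exact_mod_cast hn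
  have h1 : 1 ≤ logb 2 (n : ℝ) := by
    rw [le_logb_iff_rpow_le one_lt_two (by linarith)]
    simpa using hn'
  rw [logb_lt_iff_lt_rpow one_lt_two (by linarith), rpow_logb two_pos (by norm_num) (by linarith)]
  rw [logb_lt_iff_lt_rpow one_lt_two (by linarith), rpow_natCast]
  exact_mod_cast Nat.lt_two_pow_self

/-- With `k` fixed, the upper bound for `k` is inherited by larger `n`, because `logb 2 n` increases
by at most `1 / (n * log 2)`. -/
theorem upper_bound_succ {n k : ℕ} (hn : 2 ≤ n) (hk : 3 * k ≤ n)
    (h : 2 * k * (logb 2 n - logb 2 (logb 2 n)) ≤ n) :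
    2 * k * (logb 2 (n + 1 : ℕ) - logb 2 (logb 2 (n + 1 : ℕ))) ≤ (n + 1 : ℕ) := by
  have hn' : (2 : ℝ) ≤ n := by exact_mod_cast hn
  have hk' : 3 * (k : ℝ) ≤ n := by exact_mod_cast hk
  have hl2 : 2 / 3 < log 2 := by linarith [log_two_gt_d9]
  have h1 : 0 < logb 2 (n : ℝ) := logb_pos one_lt_two (by linarith)
  have h2 : logb 2 (n : ℝ) ≤ logb 2 (n + 1 : ℕ) :=
    logb_le_logb_of_le one_lt_two (by linarith) (by push_cast; linarith)
  have h3 : logb 2 (logb 2 (n : ℝ)) ≤ logb 2 (logb 2 (n + 1 : ℕ)) :=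
    logb_le_logb_of_le one_lt_two h1 h2
  have h4 : logb 2 (n + 1 : ℕ) ≤ logb 2 n + 1 / (n * log 2) := by
    have h5 : log ((n + 1 : ℕ) / n : ℝ) ≤ 1 / n := by
      refine (log_le_sub_one_of_pos (by positivity)).trans_eq ?_
      push_cast
      field_simp
      ring
    rw [log_div (by positivity) (by positivity)] at h5
    have h6 := div_le_div_of_nonneg_right h5 (by linarith : 0 ≤ log 2)
    rw [sub_div, div_div] at h6
    simp only [logb]
    linarith
  have h7 : 2 * (k : ℝ) * (1 / (n * log 2)) ≤ 1 := by
    rw [mul_one_div, div_le_one (by positivity)]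
    nlinarith
  have h8 : 2 * (k : ℝ) * (logb 2 (n + 1 : ℕ) - logb 2 (logb 2 (n + 1 : ℕ))) ≤
      2 * k * (logb 2 n - logb 2 (logb 2 n) + 1 / (n * log 2)) := by
    refine mul_le_mul_of_nonneg_left ?_ (by positivity)
    linarith
  push_cast at *
  linarith

/-- Both bounds for `k` on the interval from `lo` to `hi`; the fraction `a / b` is a lower bound
for `logb 2 lo`. -/
theorem bounds_of_small (k lo hi a b : ℕ) (hrow : 2 ≤ lo ∧ 0 < k ∧ 0 < a ∧ 0 < b ∧
    2 ^ a ≤ lo ^ b ∧ lo ^ (2 * k) * b ^ (2 * k) ≤ 2 ^ lo * a ^ (2 * k) ∧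
    (lo < hi → 3 * k ≤ lo) ∧ 2 ^ (hi - 2) ≤ (2 * k) ^ (2 * k)) {n : ℕ}
    (h1 : lo ≤ n) (h2 : n ≤ hi) : ∃ k : ℕ, 0 < k ∧
    2 ^ (n - 2) ≤ (2 * k) ^ (2 * k) ∧ 2 * k * (logb 2 n - logb 2 (logb 2 n)) ≤ n := by
  obtain ⟨hlo, hk0, ha, hb, hab, hbase, hk, hhi⟩ := hrow
  refine ⟨k, hk0, (Nat.pow_le_pow_right two_pos (by omega)).trans hhi, ?_⟩
  induction n, h1 using Nat.le_induction with
  | base =>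
    have hlo' : (2 : ℝ) ≤ lo := by exact_mod_cast hlo
    have hb' : (0 : ℝ) < b := by exact_mod_cast hb
    have ha' : (0 : ℝ) < a := by exact_mod_cast ha
    have h3 : (a / b : ℝ) ≤ logb 2 lo := by
      have h4 : ((2 : ℝ)) ^ a ≤ (lo : ℝ) ^ b := by exact_mod_cast hab
      have h5 := logb_le_logb_of_le one_lt_two (by positivity) h4
      rw [logb_pow, logb_pow, logb_self_eq_one one_lt_two, mul_one] at h5
      rw [div_le_iff₀ hb']
      linarith
    have h4 : logb 2 (a / b : ℝ) ≤ logb 2 (logb 2 lo) :=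
      logb_le_logb_of_le one_lt_two (by positivity) h3
    have h5 : (lo : ℝ) ^ (2 * k) * (b : ℝ) ^ (2 * k) ≤ 2 ^ lo * (a : ℝ) ^ (2 * k) := by
      exact_mod_cast hbase
    have h6 := logb_le_logb_of_le one_lt_two (by positivity) h5
    rw [logb_mul (by positivity) (by positivity), logb_mul (by positivity) (by positivity),
      logb_pow, logb_pow, logb_pow, logb_pow, logb_self_eq_one one_lt_two] at h6
    rw [logb_div ha'.ne' hb'.ne'] at h4
    have h7 : 2 * (k : ℝ) * (logb 2 lo - logb 2 (logb 2 lo)) ≤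
        2 * k * (logb 2 lo - (logb 2 a - logb 2 b)) :=
      mul_le_mul_of_nonneg_left (by linarith) (by positivity)
    push_cast at h6
    linarith
  | succ m hm ih =>
    exact upper_bound_succ (by omega) ((hk (by omega)).trans hm) (ih (by omega))

/-- For `n < 256` the bounds are checked on twenty intervals, each with its own `k`. -/
theorem exists_bounds_of_lt {n : ℕ} (hn : 3 ≤ n) (hn' : n < 256) : ∃ k : ℕ, 0 < k ∧
    2 ^ (n - 2) ≤ (2 * k) ^ (2 * k) ∧ 2 * k * (logb 2 n - logb 2 (logb 2 n)) ≤ n := by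
  rcases le_or_gt n 4 with h | h
  · exact bounds_of_small 1 3 4 3 2 (by norm_num) (by omega) h
  rcases le_or_gt n 5 with h | h
  · exact bounds_of_small 2 5 5 9 4 (by norm_num) (by omega) h
  rcases le_or_gt n 10 with h | h
  · exact bounds_of_small 2 6 10 5 2 (by norm_num) (by omega) h
  rcases le_or_gt n 17 with h | h
  · exact bounds_of_small 3 11 17 10 3 (by norm_num) (by omega) h
  rcases le_or_gt n 26 with h | h
  · exact bounds_of_small 4 18 26 4 1 (by norm_num) (by omega) h
  rcases le_or_gt n 35 with h | h
  · exact bounds_of_small 5 27 35 9 2 (by norm_num) (by omega) h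
  rcases le_or_gt n 45 with h | h
  · exact bounds_of_small 6 36 45 5 1 (by norm_num) (by omega) h
  rcases le_or_gt n 55 with h | h
  · exact bounds_of_small 7 46 55 5 1 (by norm_num) (by omega) h
  rcases le_or_gt n 66 with h | h
  · exact bounds_of_small 8 56 66 5 1 (by norm_num) (by omega) h
  rcases le_or_gt n 77 with h | h
  · exact bounds_of_small 9 67 77 6 1 (by norm_num) (by omega) h
  rcases le_or_gt n 88 with h | h
  · exact bounds_of_small 10 78 88 6 1 (by norm_num) (by omega) h
  rcases le_or_gt n 100 with h | h
  · exact bounds_of_small 11 89 100 6 1 (by norm_num) (by omega) h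
  rcases le_or_gt n 112 with h | h
  · exact bounds_of_small 12 101 112 6 1 (by norm_num) (by omega) h
  rcases le_or_gt n 124 with h | h
  · exact bounds_of_small 13 113 124 6 1 (by norm_num) (by omega) h
  rcases le_or_gt n 136 with h | h
  · exact bounds_of_small 14 125 136 6 1 (by norm_num) (by omega) h
  rcases le_or_gt n 149 with h | h
  · exact bounds_of_small 15 137 149 7 1 (by norm_num) (by omega) h
  rcases le_or_gt n 174 with h | h
  · exact bounds_of_small 17 150 174 36 5 (by norm_num) (by omega) h
  rcases le_or_gt n 201 with h | h
  · exact bounds_of_small 19 175 201 22 3 (by norm_num) (by omega) h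
  rcases le_or_gt n 228 with h | h
  · exact bounds_of_small 21 202 228 15 2 (by norm_num) (by omega) h
  rcases le_or_gt n 256 with h | h
  · exact bounds_of_small 23 229 256 15 2 (by norm_num) (by omega) h
  omega

/-- For large `n` the integer part of the upper bound itself satisfies the lower bound. -/
theorem exists_bounds_of_ge {n : ℕ} (hn : 256 ≤ n) : ∃ k : ℕ, 0 < k ∧
    2 ^ (n - 2) ≤ (2 * k) ^ (2 * k) ∧ 2 * k * (logb 2 n - logb 2 (logb 2 n)) ≤ n := by
  have hn' : (256 : ℝ) ≤ n := by exact_mod_cast hn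
  have hn0 : (0 : ℝ) < n := by linarith
  have hl2 := log_two_gt_d9
  have hl2' := log_two_lt_d9
  set l := logb 2 (n : ℝ) with hl
  have hl8 : 8 ≤ l := by
    rw [hl, le_logb_iff_rpow_le one_lt_two hn0]
    norm_num
    exact hn
  have hl0 : 0 < l := by linarith
  set m := logb 2 l with hm
  have hm3 : 3 ≤ m := by
    rw [hm, le_logb_iff_rpow_le one_lt_two hl0]
    norm_num
    exact hl8
  -- the tangent of the logarithm at `8`
  have hml : m ≤ 3 + (l - 8) / (8 * log 2) := by
    have h1 := log_le_sub_one_of_pos (show 0 < l / 8 by positivity)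
    rw [log_div hl0.ne' (by norm_num), show (8 : ℝ) = 2 ^ 3 by norm_num, log_pow] at h1
    rw [hm, logb, div_le_iff₀ (by linarith)]
    have : (3 + (l - 8) / (8 * log 2)) * log 2 = 3 * log 2 + (l - 8) / 8 := by field_simp
    rw [this]
    push_cast at h1
    linarith
  have hml' : 3 * m ≤ l + 1 := by
    have : (l - 8) / (8 * log 2) ≤ (l - 8) / 3 - (l - 8) / 8 := by
      rw [div_le_iff₀ (by linarith)]
      nlinarith
    have h2 : (l - 8) / (8 * log 2) ≤ (l - 8) / (8 * (2 / 3)) := by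
      gcongr
      · linarith
    linarith
  set q := l - m with hq
  have hq1 : 1 ≤ q := by linarith
  have hql : q ≤ l := by linarith
  set y := n / q with hy
  have hy0 : 0 < y := by positivity
  have hyq : y * q = n := by rw [hy]; field_simp
  have hlogy : logb 2 y = l - logb 2 q := by
    rw [hy, logb_div hn0.ne' (by linarith)]
  -- the gain from `logb 2 l > logb 2 q`
  have hgain : m / l / log 2 ≤ m - logb 2 q := by
    have h1 := log_le_sub_one_of_pos (show 0 < q / l by positivity)
    rw [log_div (by linarith) hl0.ne'] at h1
    have h2 : q / l = 1 - m / l := by rw [hq]; field_simp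
    have h3 : m / l ≤ log l - log q := by linarith
    have h4 := div_le_div_of_nonneg_right h3 (by linarith : 0 ≤ log 2)
    rw [sub_div] at h4
    simpa [hm, logb] using h4
  -- `n` is at least `l ^ 3 / 2`
  have hcube : l ^ 3 ≤ 2 * n := by
    have h1 : logb 2 (l ^ 3) ≤ logb 2 (2 * n) := by
      rw [logb_pow, logb_mul two_ne_zero hn0.ne', logb_self_eq_one one_lt_two, ← hm, ← hl]
      push_cast
      linarith
    exact (logb_le_logb one_lt_two (by positivity) (by positivity)).1 h1
  have hq0 : 0 ≤ logb 2 q := logb_nonneg one_lt_two hq1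
  have hyn : n / l ≤ y := by
    rw [hy]
    gcongr
  have hmain : 2 * l + 2 / log 2 - 2 ≤ y * (m - logb 2 q) := by
    have h1 : n / l * (3 / l / log 2) ≤ y * (m - logb 2 q) := by
      refine mul_le_mul hyn (le_trans ?_ hgain) (by positivity) hy0.le
      gcongr
    refine le_trans ?_ h1
    have h2 : n / l * (3 / l / log 2) = 3 * n / (l ^ 2 * log 2) := by field_simp
    have h3 : 2 * l + 2 / log 2 - 2 = (2 * l * log 2 + 2 - 2 * log 2) / log 2 := by field_simp
    rw [h2, h3, ← div_div, div_le_div_iff_of_pos_right (by linarith), le_div_iff₀ (by positivity)]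
    have h4 : 2 * l * log 2 + 2 - 2 * log 2 ≤ 3 / 2 * l := by nlinarith
    have h5 : (2 * l * log 2 + 2 - 2 * log 2) * l ^ 2 ≤ 3 / 2 * l * l ^ 2 := by gcongr
    nlinarith
  have hy4 : 4 ≤ y := by
    have h1 : 4 ≤ n / l := by
      rw [le_div_iff₀ hl0]
      nlinarith [mul_le_mul hl8 hl8 (by norm_num) hl0.le]
    linarith
  -- convexity of `x * logb 2 x`
  have hconv : (n : ℝ) - 2 ≤ (y - 2) * logb 2 (y - 2) := by
    have h1 := log_le_sub_one_of_pos (show 0 < y / (y - 2) from div_pos hy0 (by linarith))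
    rw [log_div hy0.ne' (by linarith)] at h1
    have h2 : y / (y - 2) - 1 = 2 / (y - 2) := by
      have : y - 2 ≠ 0 := by linarith
      field_simp
      ring
    rw [h2] at h1
    have h3 : logb 2 y - 2 / (y - 2) / log 2 ≤ logb 2 (y - 2) := by
      have h4 := div_le_div_of_nonneg_right h1 (by linarith : 0 ≤ log 2)
      rw [sub_div] at h4
      simp only [logb]
      linarith
    have h5 : (y - 2) * (logb 2 y - 2 / (y - 2) / log 2) ≤ (y - 2) * logb 2 (y - 2) :=
      mul_le_mul_of_nonneg_left h3 (by linarith)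
    have h6 : (y - 2) * (logb 2 y - 2 / (y - 2) / log 2) = (y - 2) * logb 2 y - 2 / log 2 := by
      have : y - 2 ≠ 0 := by linarith
      field_simp
    have h7 : (y - 2) * logb 2 y = n + y * (m - logb 2 q) - 2 * (l - logb 2 q) := by
      rw [hlogy, ← hyq, hq]
      ring
    linarith
  refine ⟨⌊y / 2⌋₊, Nat.floor_pos.2 (by linarith), ?_, ?_⟩
  · set k := ⌊y / 2⌋₊
    have hk : y - 2 ≤ 2 * k := by linarith [Nat.lt_floor_add_one (y / 2)]
    have h1 : (n : ℝ) - 2 ≤ 2 * k * logb 2 (2 * k) := by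
      refine hconv.trans (mul_le_mul hk (logb_le_logb_of_le one_lt_two (by linarith) hk)
        (logb_nonneg one_lt_two (by linarith)) (by linarith))
    have h2 : (2 : ℝ) ^ (n - 2) ≤ (2 * k) ^ (2 * k) := by
      rw [← logb_le_logb one_lt_two (by positivity) (pow_pos (by linarith) _), logb_pow, logb_pow,
        logb_self_eq_one one_lt_two, Nat.cast_sub (by omega)]
      push_cast
      linarith
    exact_mod_cast h2
  · have hk := Nat.floor_le (show 0 ≤ y / 2 by positivity)
    calc 2 * (⌊y / 2⌋₊ : ℝ) * q ≤ 2 * (y / 2) * q := by gcongr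
      _ = n := by rw [← hyq]; ring

theorem exists_isClassZero_le {n : ℕ} (hn : 3 ≤ n) :
    ∃ k : ℕ, IsClassZero (graphPower (SimpleGraph.cycleGraph n) k) ∧
      (k : ℝ) ≤ ((n : ℝ) / 2) / (logb 2 n - logb 2 (logb 2 n)) := by
  obtain ⟨k, hk, h1, h2⟩ : ∃ k : ℕ, 0 < k ∧
      2 ^ (n - 2) ≤ (2 * k) ^ (2 * k) ∧ 2 * k * (logb 2 n - logb 2 (logb 2 n)) ≤ n := by
    rcases Nat.lt_or_ge n 256 with h | h
    · exact exists_bounds_of_lt hn h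
    · exact exists_bounds_of_ge h
  refine ⟨k, isClassZero_graphPower_cycleGraph (by omega) hk h1, ?_⟩
  rw [le_div_iff₀ (sub_pos.2 (logb_logb_lt_logb (by omega)))]
  linarith

theorem le_of_isClassZero {n k : ℕ} (hn : 3 ≤ n) (h5 : n ≠ 5)
    (h : IsClassZero (graphPower (SimpleGraph.cycleGraph n) k)) :
    ((n : ℝ) / 2) / logb 2 n ≤ k := by
  have : Nontrivial (Fin n) := Fin.nontrivial_iff_two_le.2 (by omega)
  have hn' : (3 : ℝ) ≤ n := by exact_mod_cast hn
  rcases Nat.eq_zero_or_pos k with rfl | hk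
  · exact absurd h (not_isClassZero_graphPower_zero _)
  by_contra! hlt
  refine not_isClassZero_graphPower_cycleGraph hn h5 hk ?_ h
  rw [lt_div_iff₀ (logb_pos one_lt_two (by linarith))] at hlt
  have h1 : (n : ℝ) ^ (2 * k) < 2 ^ n := by
    rw [← logb_lt_logb_iff one_lt_two (by positivity) (by positivity), logb_pow, logb_pow,
      logb_self_eq_one one_lt_two]
    push_cast
    linarith
  exact_mod_cast h1

end Bounds
end GraphPebbling

theorem mainTheorem2 (n : ℕ) (hn : 3 ≤ n) :
    IsLeast {e : ℕ | GraphPebbling.IsClassZero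
        (GraphPebbling.graphPower (SimpleGraph.cycleGraph n) e)}
      (GraphPebbling.pebblingExponent (SimpleGraph.cycleGraph n)) ∧
    (n ≠ 5 → ((n : ℝ) / 2) / Real.logb 2 n ≤
      (GraphPebbling.pebblingExponent (SimpleGraph.cycleGraph n) : ℝ)) ∧
    (GraphPebbling.pebblingExponent (SimpleGraph.cycleGraph n) : ℝ) ≤
      ((n : ℝ) / 2) / (Real.logb 2 n - Real.logb 2 (Real.logb 2 n)) := by
  obtain ⟨k, hk, hle⟩ := GraphPebbling.exists_isClassZero_le hn
  have hmem : GraphPebbling.IsClassZero (GraphPebbling.graphPower (SimpleGraph.cycleGraph n)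
      (GraphPebbling.pebblingExponent (SimpleGraph.cycleGraph n))) :=
    Nat.sInf_mem (s := {e : ℕ | GraphPebbling.IsClassZero
      (GraphPebbling.graphPower (SimpleGraph.cycleGraph n) e)}) ⟨k, hk⟩
  refine ⟨⟨hmem, fun e he => Nat.sInf_le he⟩,
    fun h5 => GraphPebbling.le_of_isClassZero hn h5 hmem, le_trans ?_ hle⟩
  exact_mod_cast Nat.sInf_le hk
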